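/- Let $X$ be a real Hilbert space, let $m\ge 2$, and let $T_1,\dots,T_m\colon X\to X$ be firmly nonexpansive, i.e. $\|T_ix-T_iy\|^2\le\langle x-y,\,T_ix-T_iy\rangle$ for all $x,y\in X$. For a nonexpansive map $T\colon X\to X$ let $v_T:=P_{\overline{\operatorname{ran}}(\mathrm{Id}-T)}(0)$ be its minimal displacement vector, the unique element of least norm of the nonempty closed convex set $\overline{\{x-Tx : x\in X\}}$. Then: 1. For every $\varepsilon>0$ there exists $x\in X$ such that $\|x-T_mT_{m-1}\cdots T_1x\|\le\varepsilon+\sum_{k=1}^m\|v_{T_k}\|$. 2. $\|v_{T_m\cdots T_1}\|\le\|v_{T_1}\|+\cdots+\|v_{T_m}\|$. 3. The bound in 2 is sharp: for every $m\ge2$ and all real numbers $c_1,\dots,c_m\ge0$ there are firmly nonexpansive maps $T_1,\dots,T_m\colon\mathbb R\to\mathbb R$ with $|v_{T_i}|=c_i$ for every $i$ and $|v_{T_m\cdots T_1}|=|v_{T_1}|+\cdots+|v_{T_m}|$. Moreover, for all $a_1,a_2\in\mathbb R$, the maps $T_i\colon\mathbb R\to\mathbb R$, $x\mapsto x-a_i$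 $(i=1,2)$ are firmly nonexpansive and satisfy $v_{T_1}=a_1$, $v_{T_2}=a_2$, $v_{T_2T_1}=a_1+a_2$, and $|v_{T_2T_1}|=|v_{T_1}|+|v_{T_2}|$ holds if and only if $a_1a_2\ge0$. -/

import Mathlib

open scoped InnerProductSpace

/-- `T` is firmly nonexpansive: `‖Tx - Ty‖² ≤ ⟪x - y, Tx - Ty⟫` for all `x`, `y`. -/
def FirmlyNonexpansive {X : Type*} [NormedAddCommGroup X] [InnerProductSpace ℝ X]
    (T : X → X) : Prop :=
  ∀ x y : X, ‖T x - T y‖ ^ 2 ≤ ⟪x - y, T x - T y⟫_ℝ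

/-- `p` is a nearest point to `x` in the set `C`. -/
def IsNearestPoint {X : Type*} [NormedAddCommGroup X] (C : Set X) (x p : X) : Prop :=
  p ∈ C ∧ ∀ y ∈ C, ‖x - p‖ ≤ ‖x - y‖

open Classical in
/-- The projection `P_C x` of `x` onto `C`: the point of `C` nearest to `x`. For a nonempty closed
convex subset of a Hilbert space it exists and is unique, see `existsUnique_isNearestPoint`; the
default value `0` is used only for sets without a nearest point to `x`. -/
noncomputable def metricProj {X : Type*} [NormedAddCommGroup X] (C : Set X) (x : X) : X :=
  if h : ∃ p, IsNearestPoint C x p then h.choose else 0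

/-- The closure of the range of `Id - T`. -/
def displacementClosure {X : Type*} [NormedAddCommGroup X] (T : X → X) : Set X :=
  closure (Set.range fun x => x - T x)

/-- The minimal displacement vector `v_T`, the projection of `0` onto the closure of
`ran (Id - T)`. It is well defined for nonexpansive `T`, see `minDisplacement_spec`. -/
noncomputable def minDisplacement {X : Type*} [NormedAddCommGroup X] (T : X → X) : X :=
  metricProj (displacementClosure T) 0

/-- The composition `T_m ∘ ⋯ ∘ T_1` of a family indexed by `Fin m` (index `0` acts first). -/
def composition {X : Type*} : {m : ℕ} → (Fin m → X → X) → X → X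
  | 0, _ => id
  | m + 1, T => T (Fin.last m) ∘ composition fun i : Fin m => T i.castSucc

theorem existsUnique_isNearestPoint {X : Type*} [NormedAddCommGroup X] [InnerProductSpace ℝ X]
    [CompleteSpace X] {C : Set X} (hne : C.Nonempty) (hcl : IsClosed C) (hcv : Convex ℝ C)
    (x : X) : ∃! p, IsNearestPoint C x p := by
  have key : ∀ p, IsNearestPoint C x p → ∀ w ∈ C, ⟪x - p, w - p⟫_ℝ ≤ 0 := by
    rintro p ⟨hp, hmin⟩
    refine (norm_eq_iInf_iff_real_inner_le_zero hcv hp).1 (le_antisymm ?_ ?_)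
    · have : Nonempty C := hne.to_subtype
      exact le_ciInf fun y => hmin y y.2
    · exact ciInf_le ⟨0, by rintro _ ⟨y, rfl⟩; exact norm_nonneg _⟩ (⟨p, hp⟩ : C)
  obtain ⟨p, hp, hpe⟩ := exists_norm_eq_iInf_of_complete_convex hne hcl.isComplete hcv x
  refine ⟨p, ⟨hp, fun y hy => hpe ▸
    ciInf_le ⟨0, by rintro _ ⟨y, rfl⟩; exact norm_nonneg _⟩ (⟨y, hy⟩ : C)⟩, fun q hq => ?_⟩
  have hp' : IsNearestPoint C x p := ⟨hp, fun y hy => hpe ▸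
    ciInf_le ⟨0, by rintro _ ⟨y, rfl⟩; exact norm_nonneg _⟩ (⟨y, hy⟩ : C)⟩
  have h1 := key p hp' q hq.1
  have h2 := key q hq p hp
  have h3 : ⟪q - p, q - p⟫_ℝ = ⟪x - p, q - p⟫_ℝ + ⟪x - q, p - q⟫_ℝ := by
    rw [← neg_sub q p, inner_neg_right, ← sub_eq_add_neg, ← inner_sub_left]
    congr 1
    abel
  have h4 : ⟪q - p, q - p⟫_ℝ = 0 := le_antisymm (by linarith) real_inner_self_nonneg
  exact sub_eq_zero.1 (inner_self_eq_zero.1 h4)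

theorem convex_displacementClosure {X : Type*} [NormedAddCommGroup X] [InnerProductSpace ℝ X]
    [CompleteSpace X] {T : X → X} (hT : LipschitzWith 1 T) :
    Convex ℝ (displacementClosure T) := by
  have hmono : ∀ x z : X, 0 ≤ ⟪(x - T x) - (z - T z), x - z⟫_ℝ := by
    intro x z
    have h1 : ‖T x - T z‖ ≤ ‖x - z‖ := by simpa using hT.norm_sub_le x z
    have h2 : ⟪T x - T z, x - z⟫_ℝ ≤ ‖x - z‖ * ‖x - z‖ :=
      (real_inner_le_norm _ _).trans (by gcongr)
    have h3 : (x - T x) - (z - T z) = (x - z) - (T x - T z) := by abel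
    rw [h3, inner_sub_left, real_inner_self_eq_norm_mul_norm]
    linarith
  have hres : ∀ (w : X) (e : ℝ), 0 < e → ∃ x, e • x + (x - T x) = w := by
    intro w e he
    have hk : (1 + e)⁻¹ < 1 := inv_lt_one_of_one_lt₀ (by linarith)
    have hk0 : 0 ≤ (1 + e)⁻¹ := by positivity
    have hc : ContractingWith (⟨(1 + e)⁻¹, hk0⟩ : NNReal) fun x => (1 + e)⁻¹ • (T x + w) := by
      refine ⟨by exact_mod_cast hk, LipschitzWith.of_dist_le_mul fun x y => ?_⟩
      have h1 : ‖T x - T y‖ ≤ ‖x - y‖ := by simpa using hT.norm_sub_le x y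
      rw [dist_eq_norm, dist_eq_norm, ← smul_sub, add_sub_add_right_eq_sub, norm_smul,
        Real.norm_of_nonneg hk0]
      exact mul_le_mul_of_nonneg_left h1 hk0
    have hx := hc.fixedPoint_isFixedPt
    set x := ContractingWith.fixedPoint _ hc
    have hx' : (1 + e)⁻¹ • (T x + w) = x := hx
    refine ⟨x, ?_⟩
    have h2 : T x + w = (1 + e) • x := by
      rw [← hx', smul_smul, mul_inv_cancel₀ (by positivity), one_smul, hx']
    have h3 : w = (1 + e) • x - T x := by rw [← h2]; abel
    rw [h3, add_smul, one_smul]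
    abel
  have hrange : ∀ z₀ z₁ : X, ∀ a b : ℝ, 0 ≤ a → 0 ≤ b → a + b = 1 →
      a • (z₀ - T z₀) + b • (z₁ - T z₁) ∈ displacementClosure T := by
    intro z₀ z₁ a b ha hb hab
    set y₀ := z₀ - T z₀ with hy₀
    set y₁ := z₁ - T z₁ with hy₁
    set w := a • y₀ + b • y₁ with hw
    set N := ‖a • z₀ + b • z₁‖
    set K := |a * ⟪w - y₀, z₀⟫_ℝ + b * ⟪w - y₁, z₁⟫_ℝ|
    have hN : 0 ≤ N := norm_nonneg _
    have hK : 0 ≤ K := abs_nonneg _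
    refine Metric.mem_closure_iff.2 fun d hd => ?_
    obtain ⟨e, he, hed⟩ : ∃ e : ℝ, 0 < e ∧ e * (N * d + K) < d ^ 2 := by
      refine ⟨d ^ 2 / (N * d + K + 1), by positivity, ?_⟩
      rw [div_mul_eq_mul_div, div_lt_iff₀ (by positivity)]
      nlinarith [pow_pos hd 2]
    obtain ⟨x, hx⟩ := hres w e he
    have hF : x - T x = w - e • x := by rw [← hx]; abel
    refine ⟨_, ⟨x, rfl⟩, ?_⟩
    have hd' : dist w (x - T x) = e * ‖x‖ := by
      rw [hF, dist_eq_norm, sub_sub_cancel, norm_smul, Real.norm_of_nonneg he.le]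
    simp only [hd']
    have m0 := hmono x z₀
    have m1 := hmono x z₁
    rw [hF] at m0 m1
    rw [← hy₀] at m0
    rw [← hy₁] at m1
    have hsum : 0 ≤ a * ⟪w - e • x - y₀, x - z₀⟫_ℝ + b * ⟪w - e • x - y₁, x - z₁⟫_ℝ := by
      positivity
    have hb' : b = 1 - a := by linarith
    have hex : a * ⟪w - e • x - y₀, x - z₀⟫_ℝ + b * ⟪w - e • x - y₁, x - z₁⟫_ℝ =
        - (e * ‖x‖ ^ 2) + e * ⟪x, a • z₀ + b • z₁⟫_ℝ
          - (a * ⟪w - y₀, z₀⟫_ℝ + b * ⟪w - y₁, z₁⟫_ℝ) := by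
      have hwx : ⟪w, x⟫_ℝ = a * ⟪y₀, x⟫_ℝ + b * ⟪y₁, x⟫_ℝ := by
        rw [hw, inner_add_left, real_inner_smul_left, real_inner_smul_left]
      simp only [inner_sub_left, inner_sub_right, inner_add_right, real_inner_smul_left,
        real_inner_smul_right, real_inner_self_eq_norm_sq, hwx]
      rw [hb']
      ring
    have hc1 : ⟪x, a • z₀ + b • z₁⟫_ℝ ≤ ‖x‖ * N := real_inner_le_norm _ _
    have hc2 := neg_abs_le (a * ⟪w - y₀, z₀⟫_ℝ + b * ⟪w - y₁, z₁⟫_ℝ)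
    have hc3 : e * ‖x‖ ^ 2 ≤ e * (‖x‖ * N) + K := by
      have := mul_le_mul_of_nonneg_left hc1 he.le
      rw [hex] at hsum
      linarith
    by_contra! hcon
    have hnx : 0 ≤ ‖x‖ := norm_nonneg _
    have hs : 0 < e * ‖x‖ := hd.trans_le hcon
    have h5 : (e * ‖x‖) ^ 2 ≤ e * (N * (e * ‖x‖) + K) := by
      nlinarith [mul_le_mul_of_nonneg_left hc3 he.le]
    set s := e * ‖x‖
    have h6 : s * (s - e * N) ≤ e * K := by nlinarith
    have h7 : d * (d - e * N) ≤ s * (s - e * N) := by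
      have : 0 ≤ d - e * N := by
        by_contra! hneg
        nlinarith [mul_nonneg he.le hK]
      nlinarith
    nlinarith
  intro p hp q hq a b ha hb hab
  have := map_mem_closure₂ (f := fun p q : X => a • p + b • q) (by fun_prop) hp hq
    (u := displacementClosure T) (by
      rintro _ ⟨z₀, rfl⟩ _ ⟨z₁, rfl⟩
      exact hrange z₀ z₁ a b ha hb hab)
  rwa [IsClosed.closure_eq (by exact isClosed_closure)] at this

/-- For nonexpansive `T`, the vector `v_T` is the unique element of least norm in the closure of
`ran (Id - T)`. -/
theorem minDisplacement_spec {X : Type*} [NormedAddCommGroup X] [InnerProductSpace ℝ X]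
    [CompleteSpace X] {T : X → X} (hT : LipschitzWith 1 T) (v : X) :
    v = minDisplacement T ↔
      v ∈ displacementClosure T ∧ ∀ y ∈ displacementClosure T, ‖v‖ ≤ ‖y‖ := by
  have hu : ∃! p, IsNearestPoint (displacementClosure T) 0 p :=
    existsUnique_isNearestPoint ((Set.range_nonempty fun x => x - T x).mono subset_closure) isClosed_closure
      (convex_displacementClosure hT) 0
  have hv : IsNearestPoint (displacementClosure T) 0 (minDisplacement T) := by
    unfold minDisplacement metricProj
    rw [dif_pos hu.exists]
    exact hu.exists.choose_spec
  have hiff : IsNearestPoint (displacementClosure T) 0 v ↔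
      v ∈ displacementClosure T ∧ ∀ y ∈ displacementClosure T, ‖v‖ ≤ ‖y‖ := by
    simp [IsNearestPoint]
  rw [← hiff]
  exact ⟨fun h => h ▸ hv, fun h => hu.unique h hv⟩

theorem FirmlyNonexpansive.lipschitzWith {X : Type*} [NormedAddCommGroup X]
    [InnerProductSpace ℝ X] {T : X → X} (hT : FirmlyNonexpansive T) : LipschitzWith 1 T := by
  refine LipschitzWith.of_dist_le_mul fun x y => ?_
  rw [dist_eq_norm, dist_eq_norm, NNReal.coe_one, one_mul]
  have h1 := (hT x y).trans (real_inner_le_norm _ _)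
  by_contra! h
  nlinarith [norm_nonneg (x - y)]

theorem lipschitzWith_composition {X : Type*} [NormedAddCommGroup X] :
    ∀ {m : ℕ} {T : Fin m → X → X}, (∀ i, LipschitzWith 1 (T i)) →
      LipschitzWith 1 (composition T)
  | 0, _, _ => LipschitzWith.id
  | m + 1, T, hT => by
    have := (hT (Fin.last m)).comp (lipschitzWith_composition fun i : Fin m => hT i.castSucc)
    simpa [composition] using this

/-!
Pick `z i` with `‖z i - T i (z i)‖` close to `‖v_{T i}‖`. The shifted map
`S i x = T i (x + (z i - T i (z i)))` is firmly nonexpansive and fixes `T i (z i)`. A firmly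
nonexpansive map `S` with a fixed point `p` satisfies `‖S x‖² ≤ ‖x‖² + ‖p‖²`, and a bound of this
form, unlike firm nonexpansiveness, survives composition: `R = S m ∘ ⋯ ∘ S 1` is nonexpansive and
`‖R x‖² ≤ ‖x‖² + C`. For `δ > 0` Banach's fixed point theorem gives `x` with `R x = (1 + δ) x`, so
`2 δ ‖x‖² ≤ C` and `‖x - R x‖ = δ ‖x‖ = O(√δ)`. Replacing each `S i` by `T i` moves the value of the
composition by at most `∑ ‖z i - T i (z i)‖`.
-/

section Composition

variable {X : Type*} {m : ℕ}

theorem map_composition_le_add_sum {M : Type*} [AddCommMonoid M] [PartialOrder M]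
    [IsOrderedAddMonoid M] (f : X → M) {S : Fin m → X → X} {c : Fin m → M}
    (hS : ∀ i x, f (S i x) ≤ f x + c i) (x : X) :
    f (composition S x) ≤ f x + ∑ i, c i := by
  induction m with
  | zero => simp [composition]
  | succ m ih =>
    rw [Fin.sum_univ_castSucc, ← add_assoc]
    exact (hS _ _).trans (add_le_add_left (ih fun i => hS i.castSucc) _)

theorem dist_composition_le_sum [PseudoMetricSpace X] {S T : Fin m → X → X}
    (hT : ∀ i, LipschitzWith 1 (T i)) {d : Fin m → ℝ} (hST : ∀ i x, dist (S i x) (T i x) ≤ d i)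
    (x : X) : dist (composition S x) (composition T x) ≤ ∑ i, d i := by
  induction m with
  | zero => simp [composition]
  | succ m ih =>
    set s := composition (fun i : Fin m => S i.castSucc) x
    set t := composition (fun i : Fin m => T i.castSucc) x
    calc dist (S (Fin.last m) s) (T (Fin.last m) t)
        ≤ dist (S (Fin.last m) s) (T (Fin.last m) s) +
            dist (T (Fin.last m) s) (T (Fin.last m) t) := dist_triangle _ _ _
      _ ≤ d (Fin.last m) + dist s t :=
        add_le_add (hST _ _) (by simpa using (hT (Fin.last m)).dist_le_mul s t)
      _ ≤ d (Fin.last m) + ∑ i : Fin m, d i.castSucc := by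
        gcongr
        exact ih (fun i => hT i.castSucc) fun i => hST i.castSucc
      _ = ∑ i, d i := by rw [Fin.sum_univ_castSucc, add_comm]

theorem composition_sub_right [AddCommGroup X] (c : Fin m → X) :
    composition (fun i x => x - c i) = fun x => x - ∑ i, c i := by
  induction m with
  | zero => funext x; simp [composition]
  | succ m ih =>
    funext x
    simp only [composition, Function.comp_apply, ih fun i => c i.castSucc, Fin.sum_univ_castSucc,
      sub_sub]

end Composition

section ApproximateFixedPoints

variable {X : Type*} [NormedAddCommGroup X] [CompleteSpace X]

theorem exists_map_eq_smul {𝕜 : Type*} [NormedField 𝕜] [NormedSpace 𝕜 X] {K : NNReal} {R : X → X}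
    (hR : LipschitzWith K R) {r : 𝕜} (hr : K < ‖r‖₊) : ∃ x, R x = r • x := by
  have hr₀ : 0 < ‖r‖₊ := hr.pos
  have hc : ContractingWith (‖r⁻¹‖₊ * K) fun x => r⁻¹ • R x := by
    refine ⟨?_, (lipschitzWith_smul r⁻¹).comp hR⟩
    rwa [nnnorm_inv, inv_mul_lt_one₀ hr₀]
  have hx := hc.fixedPoint_isFixedPt
  exact ⟨_, (inv_smul_eq_iff₀ (nnnorm_pos.1 hr₀)).1 hx⟩

theorem exists_norm_sub_map_le_of_norm_sq_map_le [NormedSpace ℝ X] {R : X → X}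
    (hR : LipschitzWith 1 R) {C : ℝ} (hC : ∀ x, ‖R x‖ ^ 2 ≤ ‖x‖ ^ 2 + C) {ε : ℝ} (hε : 0 < ε) :
    ∃ x, ‖x - R x‖ ≤ ε := by
  have hC₀ : 0 ≤ C := by simpa using (sq_nonneg _).trans (hC 0)
  obtain ⟨δ, hδ, hδC⟩ : ∃ δ : ℝ, 0 < δ ∧ δ * C ≤ ε ^ 2 := by
    refine ⟨ε ^ 2 / (C + 1), by positivity, ?_⟩
    rw [div_mul_eq_mul_div, div_le_iff₀ (by positivity)]
    gcongr
    linarith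
  have hδ₁ : ‖1 + δ‖ = 1 + δ := Real.norm_of_nonneg (by positivity)
  obtain ⟨x, hx⟩ := exists_map_eq_smul hR (r := 1 + δ) <| by
    rw [← NNReal.coe_lt_coe, coe_nnnorm, hδ₁, NNReal.coe_one]
    linarith
  have hgrowth : (1 + δ) ^ 2 * ‖x‖ ^ 2 ≤ ‖x‖ ^ 2 + C := by
    simpa only [hx, norm_smul, hδ₁, mul_pow] using hC x
  have hdisp : ‖x - R x‖ = δ * ‖x‖ := by
    rw [hx, add_smul, one_smul, sub_add_cancel_left, norm_neg, norm_smul,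
      Real.norm_of_nonneg hδ.le]
  have hbound : δ * ‖x‖ ^ 2 ≤ C := by
    nlinarith [mul_nonneg hδ.le (sq_nonneg ‖x‖), mul_nonneg (sq_nonneg δ) (sq_nonneg ‖x‖)]
  refine ⟨x, hdisp ▸ le_of_sq_le_sq ?_ hε.le⟩
  calc (δ * ‖x‖) ^ 2 = δ * (δ * ‖x‖ ^ 2) := by ring
    _ ≤ δ * C := by gcongr
    _ ≤ ε ^ 2 := hδC

end ApproximateFixedPoints

section MinDisplacement

variable {X : Type*} [NormedAddCommGroup X]

theorem metricProj_singleton (a x : X) : metricProj {a} x = a := by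
  have h : ∃ p, IsNearestPoint {a} x p := ⟨a, rfl, by simp⟩
  rw [metricProj, dif_pos h]
  exact h.choose_spec.1

theorem minDisplacement_sub_right (a : X) : minDisplacement (fun x => x - a) = a := by
  simp [minDisplacement, displacementClosure, metricProj_singleton]

variable [InnerProductSpace ℝ X] [CompleteSpace X] {T : X → X}

theorem norm_minDisplacement_le (hT : LipschitzWith 1 T) (x : X) :
    ‖minDisplacement T‖ ≤ ‖x - T x‖ :=
  ((minDisplacement_spec hT _).1 rfl).2 _ (subset_closure ⟨x, rfl⟩)

theorem exists_norm_sub_map_lt (hT : LipschitzWith 1 T) {ε : ℝ} (hε : 0 < ε) :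
    ∃ z, ‖z - T z‖ < ‖minDisplacement T‖ + ε := by
  have hv : minDisplacement T ∈ displacementClosure T := ((minDisplacement_spec hT _).1 rfl).1
  obtain ⟨_, ⟨z, rfl⟩, hz⟩ := Metric.mem_closure_iff.1 hv ε hε
  refine ⟨z, ?_⟩
  rw [dist_comm, dist_eq_norm] at hz
  have := norm_le_norm_add_norm_sub' (z - T z) (minDisplacement T)
  linarith

end MinDisplacement

section FirmlyNonexpansive

variable {X : Type*} [NormedAddCommGroup X] [InnerProductSpace ℝ X]

theorem firmlyNonexpansive_sub_right (a : X) : FirmlyNonexpansive fun x => x - a := by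
  intro x y
  rw [sub_sub_sub_cancel_right, real_inner_self_eq_norm_sq]

namespace FirmlyNonexpansive

theorem comp_add_right {T : X → X} (hT : FirmlyNonexpansive T) (a : X) :
    FirmlyNonexpansive fun x => T (x + a) := fun x y => by
  simpa only [add_sub_add_right_eq_sub] using hT (x + a) (y + a)

theorem norm_sq_map_le {T : X → X} (hT : FirmlyNonexpansive T) {p : X}
    (hp : Function.IsFixedPt T p) (x : X) : ‖T x‖ ^ 2 ≤ ‖x‖ ^ 2 + ‖p‖ ^ 2 := by
  -- `⟪x - T x, p - T x⟫ ≤ 0` in expanded form: `T x` is in the ball with diameter `[x, p]`.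
  have hball : ‖T x - p‖ ^ 2 ≤ ⟪x - p, T x - p⟫_ℝ := by simpa only [hp.eq] using hT x p
  have hidentity : ‖T x‖ ^ 2 + ‖x + p - T x‖ ^ 2 =
      ‖x‖ ^ 2 + ‖p‖ ^ 2 + 2 * (‖T x - p‖ ^ 2 - ⟪x - p, T x - p⟫_ℝ) := by
    simp only [← real_inner_self_eq_norm_sq, inner_sub_left, inner_sub_right, inner_add_left,
      inner_add_right, real_inner_comm x (T x), real_inner_comm p (T x), real_inner_comm x p]
    ring
  linarith [sq_nonneg ‖x + p - T x‖]

variable [CompleteSpace X] {m : ℕ} {T : Fin m → X → X}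

theorem exists_norm_sub_composition_le_of_isFixedPt (hT : ∀ i, FirmlyNonexpansive (T i))
    {p : Fin m → X} (hp : ∀ i, Function.IsFixedPt (T i) (p i)) {ε : ℝ} (hε : 0 < ε) :
    ∃ x, ‖x - composition T x‖ ≤ ε :=
  exists_norm_sub_map_le_of_norm_sq_map_le
    (lipschitzWith_composition fun i => (hT i).lipschitzWith)
    (map_composition_le_add_sum (‖·‖ ^ 2) fun i => (hT i).norm_sq_map_le (hp i)) hε

theorem exists_norm_sub_composition_le_add_sum (hT : ∀ i, FirmlyNonexpansive (T i))
    (z : Fin m → X) {ε : ℝ} (hε : 0 < ε) :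
    ∃ x, ‖x - composition T x‖ ≤ ε + ∑ i, ‖z i - T i (z i)‖ := by
  let S : Fin m → X → X := fun i x => T i (x + (z i - T i (z i)))
  have hfix : ∀ i, Function.IsFixedPt (S i) (T i (z i)) := fun i => by
    simp only [S, Function.IsFixedPt, add_sub_cancel]
  have hST : ∀ i x, dist (S i x) (T i x) ≤ ‖z i - T i (z i)‖ := fun i x => by
    simpa using (hT i).lipschitzWith.dist_le_mul (x + (z i - T i (z i))) x
  obtain ⟨x, hx⟩ :=
    exists_norm_sub_composition_le_of_isFixedPt (fun i => (hT i).comp_add_right _) hfix hε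
  refine ⟨x, ?_⟩
  calc ‖x - composition T x‖
      ≤ ‖x - composition S x‖ + ‖composition S x - composition T x‖ :=
        norm_sub_le_norm_sub_add_norm_sub _ _ _
    _ ≤ ε + ∑ i, ‖z i - T i (z i)‖ := by
        rw [← dist_eq_norm (composition S x)]
        exact add_le_add hx (dist_composition_le_sum (fun i => (hT i).lipschitzWith) hST x)

theorem exists_norm_sub_composition_le (hT : ∀ i, FirmlyNonexpansive (T i)) {ε : ℝ}
    (hε : 0 < ε) : ∃ x, ‖x - composition T x‖ ≤ ε + ∑ i, ‖minDisplacement (T i)‖ := by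
  obtain ⟨η, hη, hmη⟩ : ∃ η : ℝ, 0 < η ∧ η + m * η = ε :=
    ⟨ε / (m + 1), by positivity, by field_simp; ring⟩
  choose z hz using fun i => exists_norm_sub_map_lt (hT i).lipschitzWith hη
  obtain ⟨x, hx⟩ := exists_norm_sub_composition_le_add_sum hT z hη
  refine ⟨x, hx.trans ?_⟩
  calc η + ∑ i, ‖z i - T i (z i)‖
      ≤ η + ∑ i, (‖minDisplacement (T i)‖ + η) := by gcongr with i; exact (hz i).le
    _ = ε + ∑ i, ‖minDisplacement (T i)‖ := by
        rw [← hmη, Finset.sum_add_distrib, Finset.sum_const, Finset.card_univ, Fintype.card_fin,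
          nsmul_eq_mul]
        ring

theorem norm_minDisplacement_composition_le (hT : ∀ i, FirmlyNonexpansive (T i)) :
    ‖minDisplacement (composition T)‖ ≤ ∑ i, ‖minDisplacement (T i)‖ := by
  refine le_of_forall_pos_le_add fun ε hε => ?_
  obtain ⟨x, hx⟩ := exists_norm_sub_composition_le hT hε
  rw [add_comm]
  exact (norm_minDisplacement_le
    (lipschitzWith_composition fun i => (hT i).lipschitzWith) x).trans hx

end FirmlyNonexpansive

end FirmlyNonexpansive

theorem mainTheorem1 :
    (∀ (X : Type*) [NormedAddCommGroup X] [InnerProductSpace ℝ X] [CompleteSpace X]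
      (m : ℕ) (_ : 2 ≤ m) (T : Fin m → X → X) (_ : ∀ i, FirmlyNonexpansive (T i)),
      (∀ ε : ℝ, 0 < ε →
        ∃ x : X, ‖x - composition T x‖ ≤ ε + ∑ k, ‖minDisplacement (T k)‖) ∧
      ‖minDisplacement (composition T)‖ ≤ ∑ k, ‖minDisplacement (T k)‖) ∧
    (∀ (m : ℕ) (_ : 2 ≤ m) (c : Fin m → ℝ) (_ : ∀ i, 0 ≤ c i),
      ∃ T : Fin m → ℝ → ℝ, (∀ i, FirmlyNonexpansive (T i)) ∧
        (∀ i, ‖minDisplacement (T i)‖ = c i) ∧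
        ‖minDisplacement (composition T)‖ = ∑ k, ‖minDisplacement (T k)‖) ∧
    (∀ (a₁ a₂ : ℝ) (T₁ T₂ : ℝ → ℝ) (_ : ∀ x, T₁ x = x - a₁) (_ : ∀ x, T₂ x = x - a₂),
      FirmlyNonexpansive T₁ ∧ FirmlyNonexpansive T₂ ∧
      minDisplacement T₁ = a₁ ∧ minDisplacement T₂ = a₂ ∧
      minDisplacement (T₂ ∘ T₁) = a₁ + a₂ ∧
      (|minDisplacement (T₂ ∘ T₁)| = |minDisplacement T₁| + |minDisplacement T₂| ↔
        0 ≤ a₁ * a₂)) := by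
  refine ⟨fun X _ _ _ m _ T hT => ⟨fun ε hε => ?_, ?_⟩, fun m _ c hc => ?_,
    fun a₁ a₂ T₁ T₂ h₁ h₂ => ?_⟩
  · exact FirmlyNonexpansive.exists_norm_sub_composition_le hT hε
  · exact FirmlyNonexpansive.norm_minDisplacement_composition_le hT
  · refine ⟨fun i x => x - c i, fun i => firmlyNonexpansive_sub_right _, fun i => ?_, ?_⟩
    · rw [minDisplacement_sub_right, Real.norm_of_nonneg (hc i)]
    · simp only [composition_sub_right, minDisplacement_sub_right, Real.norm_eq_abs,
        Finset.abs_sum_of_nonneg' hc, abs_of_nonneg (hc _)]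
  · obtain rfl : T₁ = fun x => x - a₁ := funext h₁
    obtain rfl : T₂ = fun x => x - a₂ := funext h₂
    have hcomp : ((fun x => x - a₂) ∘ fun x => x - a₁) = fun x => x - (a₁ + a₂) :=
      funext fun x => sub_sub x a₁ a₂
    simp only [hcomp, minDisplacement_sub_right, firmlyNonexpansive_sub_right, true_and]
    rw [abs_add_eq_add_abs_iff, mul_nonneg_iff]
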